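/- **Setting.** A flat cone metric $\mathbf g$ on a compact connected oriented surface $S$ with (possibly empty) piecewise geodesic boundary is given as a Euclidean polyhedral surface: $(S,\mathbf g)$ is obtained from finitely many nondegenerate Euclidean triangles by gluing some of their edges in pairs by orientation-preserving isometries (the edges that are not glued form $\partial S$; a triangle may be glued to itself, and two triangles may share several edges). Write $V,E,F$ for the numbers of vertices, edges and triangles of $S$, $\chi(S)=V-E+F$, and $b\ge 0$ for the number of connected components of $\partial S$. The surface has genus zero when $\chi(S)=2-b$. The curvature measure of a vertex $v$ is $K(v)=2\pi-\theta(v)$ if $v$ is an interior vertex and $K(v)=\pi-\theta(v)$ if $v\in\partial S$, where $\theta(v)$ is the sum of all angles of triangles at $v$. A face path is a sequence of triangles in which one passes from each triangle to the next one through a common (glued) edge. A tangent vector is parallel transported across such an edge by laying out the two triangles in the plane side by side along the edge and translating the vector. The holonomy of a face loop based at a triangle $\sigma_0$ is the rotation of the plane of $\sigma_0$ given by parallel transport along the loop; the holonomies of all face loops at $\sigma_0$ form the holonomy group of $\mathbf g$ at $\sigma_0$, a subgroup of $U(1)$. **Lemma.** Let $S$ be a surface of genus zero with a flat cone metric $\mathbf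 g$ as above. Let $\Gamma_1=\{p_1,\dots,p_n\}$ be a set of interior vertices and $\Gamma_2=\{q_1,\dots,q_m\}$ a set of boundary vertices such that $K(v)=0$ for every vertex $v\notin\Gamma_1\cup\Gamma_2$. Suppose that $$K(p_i)=\frac{k_i\pi}{2}\quad(1\le i\le n),\qquad K(q_j)=\frac{l_j\pi}{2}\quad(1\le j\le m)$$ with integers $k_i,l_j$, and that the Gauss–Bonnet condition $$\sum_{i=1}^n k_i+\sum_{j=1}^m l_j=4\chi(S)$$ holds. Then, for every base triangle $\sigma_0$, the holonomy group of $\mathbf g$ at $\sigma_0$ is contained in $\{e^{ik\pi/2}:k\in\mathbb Z\}$. -/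

import Mathlib

/-- A flat cone metric on a compact oriented surface with (possibly empty) piecewise geodesic
boundary, presented as a Euclidean polyhedral surface: finitely many Euclidean triangles, indexed
by `F`, are glued along edges by orientation-preserving isometries. (The triangulation may be
singular: a triangle may be glued to itself, and two triangles may share several edges.)

The triangle `f` has the corners `point f 0`, `point f 1`, `point f 2` in the plane `ℂ`, in
counterclockwise order. A pair `d = (f, i)` stands both for the corner `point f i` of `f` and for
the oriented edge of `f` that runs from `point f i` to `point f (i + 1)`. The edge `d` is
identified with the edge `glue d`, with the directions reversed, when `glue d ≠ d`; it lies on the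
boundary of the surface when `glue d = d`. -/
structure FlatConeSurface (F : Type*) where
  point : F → Fin 3 → ℂ
  counterclockwise : ∀ f,
    0 < ((starRingEnd ℂ) (point f 1 - point f 0) * (point f 2 - point f 0)).im
  glue : F × Fin 3 → F × Fin 3
  glue_glue : ∀ d, glue (glue d) = d
  dist_glue : ∀ d,
    dist (point (glue d).1 (glue d).2) (point (glue d).1 ((glue d).2 + 1)) =
      dist (point d.1 d.2) (point d.1 (d.2 + 1))

namespace FlatConeSurface

variable {F : Type*} (P : FlatConeSurface F)

/-- The edge vector of the oriented edge `d`, in the coordinates of its triangle. -/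
def edgeVector (d : F × Fin 3) : ℂ := P.point d.1 (d.2 + 1) - P.point d.1 d.2

theorem edgeVector_ne_zero (d : F × Fin 3) : P.edgeVector d ≠ 0 := by
  obtain ⟨f, i⟩ := d
  intro h
  have hpos := P.counterclockwise f
  unfold edgeVector at h
  fin_cases i
  · have h1 : P.point f 1 - P.point f 0 = 0 := by simpa using h
    simp [h1] at hpos
  · have h1 : P.point f 2 = P.point f 1 := sub_eq_zero.mp (by simpa using h)
    rw [h1, mul_comm, Complex.mul_conj] at hpos
    simp at hpos
  · have h1 : P.point f 2 - P.point f 0 = 0 := by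
      have h2 : P.point f 0 - P.point f 2 = 0 := by simpa using h
      rw [← neg_sub, h2, neg_zero]
    simp [h1] at hpos

/-! ### Topology -/

/-- `d` is an edge on the boundary of the surface. -/
def IsBoundaryEdge (d : F × Fin 3) : Prop := P.glue d = d

/-- The end point of the oriented edge `d`, as a corner of the same triangle. -/
def next (d : F × Fin 3) : F × Fin 3 := (d.1, d.2 + 1)

/-- Gluing `d` to `glue d`, with reversed direction, identifies the starting corner of `d` with
the end corner of `glue d`. (The other pair of corners is identified by the same rule for
`glue d`.) -/
def CornerRel (c c' : F × Fin 3) : Prop := ¬ P.IsBoundaryEdge c ∧ c' = next (P.glue c)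

/-- The vertices of the glued surface: corners of triangles modulo the equivalence relation
generated by the gluing. -/
def Vertex : Type _ := Quot P.CornerRel

/-- The vertex of the surface at a corner of a triangle. -/
def vertex (c : F × Fin 3) : P.Vertex := Quot.mk P.CornerRel c

/-- The edges of the glued surface. -/
def Edge : Type _ := Quot fun d d' : F × Fin 3 => d' = P.glue d

/-- The Euler characteristic: vertices minus edges plus faces. -/
noncomputable def eulerChar : ℤ :=
  (Nat.card P.Vertex : ℤ) - (Nat.card P.Edge : ℤ) + (Nat.card F : ℤ)

/-- The connected components of the boundary: boundary edges modulo the equivalence relation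
generated by "`d'` starts at the vertex where `d` ends". -/
def BoundaryComponent : Type _ :=
  Quot fun d d' : {d : F × Fin 3 // P.IsBoundaryEdge d} =>
    P.vertex (next d.1) = P.vertex d'.1

/-- A vertex on the boundary of the surface. -/
def IsBoundaryVertex (v : P.Vertex) : Prop :=
  ∃ d, P.IsBoundaryEdge d ∧ (P.vertex d = v ∨ P.vertex (next d) = v)

/-! ### Face paths, parallel transport and holonomy -/

/-- Face paths: sequences of triangles in which one passes from each triangle to the next one
through an interior edge, which is recorded. -/
inductive FacePath : F → F → Type _
  | nil (f : F) : FacePath f f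
  | cons {g : F} (d : F × Fin 3) (hd : ¬ P.IsBoundaryEdge d) (γ : FacePath (P.glue d).1 g) :
      FacePath d.1 g

/-- The surface is connected. -/
def Connected : Prop := Nonempty F ∧ ∀ f g, Nonempty (P.FacePath f g)

/-- A compact oriented surface has genus `g` when it is connected and its Euler characteristic is
`2 - 2g - b`, with `b` the number of boundary components. -/
def HasGenus (g : ℕ) : Prop :=
  P.Connected ∧ P.eulerChar = 2 - 2 * (g : ℤ) - (Nat.card P.BoundaryComponent : ℤ)

theorem norm_edgeRotation (d : F × Fin 3) :
    ‖-P.edgeVector (P.glue d) / P.edgeVector d‖ = 1 := by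
  have h := P.dist_glue d
  rw [dist_comm, dist_comm (P.point d.1 d.2), dist_eq_norm, dist_eq_norm] at h
  have h' : ‖P.edgeVector (P.glue d)‖ = ‖P.edgeVector d‖ := h
  rw [norm_div, norm_neg, h']
  exact div_self (norm_ne_zero_iff.mpr (P.edgeVector_ne_zero d))

/-- Parallel transport across the edge `d`. When the two triangles that meet at this edge are laid
out in the plane side by side, a translated tangent vector with coordinate `v` in the first
triangle has the coordinate `edgeRotation d * v` in the second one: this is the rotation that
takes the edge vector of `d` to the negative of the edge vector of `glue d`. -/
noncomputable def edgeRotation (d : F × Fin 3) : Circle :=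
  ⟨-P.edgeVector (P.glue d) / P.edgeVector d, mem_sphere_zero_iff_norm.mpr (P.norm_edgeRotation d)⟩

variable {P} in
/-- Parallel transport along a face path from `f` to `g` takes the tangent vector with coordinate
`v` in `f` to the one with coordinate `transport γ * v` in `g`. For a face loop `γ`, the rotation
`transport γ` is the holonomy of `γ`. -/
noncomputable def transport : {f g : F} → P.FacePath f g → Circle
  | _, _, .nil _ => 1
  | _, _, .cons d _ γ => transport γ * P.edgeRotation d

theorem exists_transport_mul {f g h : F} (γ : P.FacePath f g) (η : P.FacePath g h) :
    ∃ ζ : P.FacePath f h, transport ζ = transport η * transport γ := by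
  induction γ with
  | nil f => exact ⟨η, by simp [transport]⟩
  | cons d hd γ ih =>
    obtain ⟨ζ, hζ⟩ := ih η
    exact ⟨.cons d hd ζ, by simp [transport, hζ, mul_assoc]⟩

theorem exists_transport_edge_inv (d : F × Fin 3) (hd : ¬ P.IsBoundaryEdge d) :
    ∃ ζ : P.FacePath (P.glue d).1 d.1, transport ζ = (P.edgeRotation d)⁻¹ := by
  have key : ∀ e, P.glue (P.glue d) = e →
      ∃ ζ : P.FacePath (P.glue d).1 e.1, transport ζ = (P.edgeRotation d)⁻¹ := by
    rintro e rfl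
    have hd' : ¬ P.IsBoundaryEdge (P.glue d) := fun h =>
      hd (by unfold IsBoundaryEdge at h ⊢; rw [P.glue_glue] at h; exact h.symm)
    refine ⟨.cons (P.glue d) hd' (.nil _), ?_⟩
    simp only [transport, one_mul]
    apply Subtype.ext
    rw [Circle.coe_inv]
    simp only [edgeRotation, P.glue_glue]
    rw [inv_div, neg_div, div_neg]
  exact key d (P.glue_glue d)

theorem exists_transport_inv {f g : F} (γ : P.FacePath f g) :
    ∃ ζ : P.FacePath g f, transport ζ = (transport γ)⁻¹ := by
  induction γ with
  | nil f => exact ⟨.nil f, by simp [transport]⟩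
  | cons d hd γ ih =>
    obtain ⟨ζ, hζ⟩ := ih
    obtain ⟨ξ, hξ⟩ := P.exists_transport_edge_inv d hd
    obtain ⟨ω, hω⟩ := P.exists_transport_mul ζ ξ
    exact ⟨ω, by rw [hω, hζ, hξ, transport, mul_inv_rev]⟩

/-- The holonomy group at the base face `f`: the holonomies of all face loops at `f`. -/
noncomputable def holonomyGroup (f : F) : Subgroup Circle where
  carrier := {a | ∃ γ : P.FacePath f f, transport γ = a}
  mul_mem' := by
    rintro _ _ ⟨γ, rfl⟩ ⟨η, rfl⟩
    exact P.exists_transport_mul η γ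
  one_mem' := ⟨.nil f, rfl⟩
  inv_mem' := by
    rintro _ ⟨γ, rfl⟩
    exact P.exists_transport_inv γ

/-! ### Curvature -/

/-- The interior angle at the corner `c` of a triangle. -/
noncomputable def cornerAngle (c : F × Fin 3) : ℝ :=
  EuclideanGeometry.angle (P.point c.1 (c.2 + 1)) (P.point c.1 c.2) (P.point c.1 (c.2 + 2))

open Classical in
/-- The total angle of the surface at a vertex. -/
noncomputable def totalAngle [Fintype F] (v : P.Vertex) : ℝ :=
  ∑ c : F × Fin 3, if P.vertex c = v then P.cornerAngle c else 0

open Classical in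
/-- The curvature measure of a vertex: `2π` minus the total angle at an interior vertex, and `π`
minus the total angle at a boundary vertex. -/
noncomputable def curvature [Fintype F] (v : P.Vertex) : ℝ :=
  (if P.IsBoundaryVertex v then Real.pi else 2 * Real.pi) - P.totalAngle v

end FlatConeSurface

/-- The group `{e^{ikπ/2} : k ∈ ℤ}` of rotations of the plane by multiples of a right angle. -/
noncomputable def quarterTurns : Subgroup Circle :=
  Subgroup.zpowers (Circle.exp (Real.pi / 2))

/-!
Parallel transport takes values in the abelian group `U(1)`, so its fourth power is a flat cochain
on the graph dual to the triangulation, and the claim is that this cochain is a coboundary: if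
`edgeRotation d ^ 4` is `exp (2π (h (glue d).1 - h d.1))` for a function `h` on the triangles, the
fourth power of the transport along a path depends on the end points only, and quarter turns are
exactly the rotations whose fourth power is trivial.

The boundary is handled by collapsing each of its components to a point. Combinatorially, the
permutation `rotation : d ↦ next (glue d)` of the corners turns around interior vertices, and at a
boundary edge (where `glue d = d`) it moves on to the next boundary vertex. Its cycles are therefore
the vertices of the closed surface: the interior vertices and the boundary components. The product
of the edge rotations along a cycle is `exp` of the sum of the angles along it
(`prod_edgeRotation`; a boundary edge contributes `-1`, whose fourth power is `1`).
Since every total angle is a multiple of `π / 2`, the fourth power is trivial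
(`prod_edgeRotation_pow_four`).

It remains to see that a cochain with values in `ℝ / ℤ` that is trivial on all cycles is a
coboundary. Lift it to an antisymmetric real function `x` on the oriented edges. Its divergence is
an integer at each vertex of the closed surface, with total zero; by connectedness there is an
antisymmetric integer function with the same divergence (`Connected.mem_divergenceRange`).
Subtracting it does not change the cochain and makes `x` divergence-free. Over `ℝ`, coboundaries
are divergence-free, and in genus zero the dimensions agree (`HasGenus.exists_coboundary_eq`): the
coboundaries have dimension at least `#F - 1`, the divergences at least `#W - 1` with `W` the
vertices of the closed surface, and the antisymmetric functions at most the number of interior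
edges, which is at most `#W + #F - 2` by Euler's formula (`HasGenus.card_interiorEdge_add_two_le`).
-/

open scoped Real

namespace FlatConeSurface

variable {F : Type*} (P : FlatConeSurface F)

/-! ### The rotation of corners and the closed-up surface -/

/-- The permutation of the corners that turns around the vertices of the surface: an interior edge
`d` is crossed, and the next corner at the same vertex is reached. At a boundary edge `d` it moves
on to the next vertex along the boundary instead. -/
def rotation : Equiv.Perm (F × Fin 3) where
  toFun d := next (P.glue d)
  invFun d := P.glue (d.1, d.2 - 1)
  left_inv d := by simp [next, P.glue_glue]
  right_inv d := by simp [next, P.glue_glue]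

theorem rotation_apply (d : F × Fin 3) : P.rotation d = next (P.glue d) := rfl

/-- The vertices of the closed surface in which each boundary component is collapsed to a point:
the cycles of `rotation`. -/
def ClosedVertex : Type _ := Quotient (Equiv.Perm.SameCycle.setoid P.rotation)

/-- The vertex of the closed surface at a corner of a triangle. -/
def closedVertex (d : F × Fin 3) : P.ClosedVertex :=
  Quotient.mk (Equiv.Perm.SameCycle.setoid P.rotation) d

theorem closedVertex_eq_iff {c d : F × Fin 3} :
    P.closedVertex c = P.closedVertex d ↔ P.rotation.SameCycle c d :=
  Quotient.eq (r := Equiv.Perm.SameCycle.setoid P.rotation)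

theorem closedVertex_rotation (d : F × Fin 3) :
    P.closedVertex (P.rotation d) = P.closedVertex d :=
  P.closedVertex_eq_iff.2 (Equiv.Perm.sameCycle_apply_left.2 (Equiv.Perm.SameCycle.refl _ _))

theorem closedVertex_next (d : F × Fin 3) :
    P.closedVertex (next d) = P.closedVertex (P.glue d) := by
  rw [← P.closedVertex_rotation (P.glue d), rotation_apply, P.glue_glue]

instance [Finite F] : Finite P.ClosedVertex := inferInstanceAs (Finite (Quotient _))
instance [Finite F] : Finite P.Vertex := inferInstanceAs (Finite (Quot _))
instance [Finite F] : Finite P.Edge := inferInstanceAs (Finite (Quot _))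
instance [Finite F] : Finite P.BoundaryComponent := inferInstanceAs (Finite (Quot _))

noncomputable instance [Finite F] : Fintype P.ClosedVertex := Fintype.ofFinite _
noncomputable instance [Finite F] : Fintype P.Vertex := Fintype.ofFinite _

theorem vertex_rotation {d : F × Fin 3} (hd : ¬ P.IsBoundaryEdge d) :
    P.vertex (P.rotation d) = P.vertex d :=
  (Quot.sound ⟨hd, rfl⟩ : P.vertex d = P.vertex (P.rotation d)).symm

theorem rotation_of_isBoundaryEdge {d : F × Fin 3} (hd : P.IsBoundaryEdge d) :
    P.rotation d = next d := by
  rw [rotation_apply, hd]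

/-- The cycles of `rotation` are unions of vertices. -/
theorem closedVertex_eq_of_vertex_eq {c d : F × Fin 3} (h : P.vertex c = P.vertex d) :
    P.closedVertex c = P.closedVertex d := by
  have key : ∀ a b, P.CornerRel a b → P.closedVertex a = P.closedVertex b := by
    rintro a _ ⟨-, rfl⟩
    exact (P.closedVertex_rotation a).symm
  exact congrArg (Quot.lift P.closedVertex key) h

/-- A corner at a vertex of the surface. -/
noncomputable def cornerAt (v : P.Vertex) : F × Fin 3 := Quot.out v

theorem vertex_cornerAt (v : P.Vertex) : P.vertex (P.cornerAt v) = v := Quot.out_eq v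

/-! ### Counting vertices and edges -/

/-- The component of a boundary edge in the boundary. -/
def boundaryComponent (d : F × Fin 3) (hd : P.IsBoundaryEdge d) : P.BoundaryComponent :=
  Quot.mk _ ⟨d, hd⟩

theorem vertex_rotation_pow {c : F × Fin 3} (hc : ¬ P.IsBoundaryVertex (P.vertex c)) (n : ℕ) :
    P.vertex ((P.rotation ^ n) c) = P.vertex c := by
  induction n with
  | zero => simp
  | succ n ih =>
    rw [pow_succ', Equiv.Perm.mul_apply, P.vertex_rotation, ih]
    exact fun h => hc ⟨_, h, .inl ih⟩

/-- From the end of a boundary edge on, every iterate of `rotation` stays at the end vertex of some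
edge of the same boundary component. -/
theorem exists_boundaryEdge_vertex_rotation_pow {d : F × Fin 3} (hd : P.IsBoundaryEdge d) (n : ℕ) :
    ∃ (e : F × Fin 3) (he : P.IsBoundaryEdge e),
      P.boundaryComponent e he = P.boundaryComponent d hd ∧
        P.vertex ((P.rotation ^ (n + 1)) d) = P.vertex (next e) := by
  induction n with
  | zero => exact ⟨d, hd, rfl, by simp [P.rotation_of_isBoundaryEdge hd]⟩
  | succ n ih =>
    obtain ⟨e, he, hcomp, hv⟩ := ih
    rw [pow_succ', Equiv.Perm.mul_apply]
    by_cases hb : P.IsBoundaryEdge ((P.rotation ^ (n + 1)) d)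
    · refine ⟨_, hb, ?_, by rw [P.rotation_of_isBoundaryEdge hb]⟩
      rw [← hcomp]
      exact (Quot.sound hv.symm : P.boundaryComponent e he = _).symm
    · exact ⟨e, he, hcomp, by rw [P.vertex_rotation hb, hv]⟩

theorem boundaryComponent_eq_of_closedVertex_eq [Finite F] {d e : F × Fin 3}
    (hd : P.IsBoundaryEdge d) (he : P.IsBoundaryEdge e)
    (h : P.closedVertex d = P.closedVertex e) :
    P.boundaryComponent d hd = P.boundaryComponent e he := by
  obtain ⟨n, hn⟩ := (P.closedVertex_eq_iff.1 h).exists_nat_pow_eq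
  cases n with
  | zero =>
    obtain rfl : d = e := by simpa using hn
    rfl
  | succ n =>
    obtain ⟨a, ha, hcomp, hv⟩ := P.exists_boundaryEdge_vertex_rotation_pow hd n
    rw [← hcomp]
    exact Quot.sound (by rw [← hv, hn])

theorem vertex_eq_of_closedVertex_eq [Finite F] {c d : F × Fin 3}
    (hc : ¬ P.IsBoundaryVertex (P.vertex c)) (h : P.closedVertex c = P.closedVertex d) :
    P.vertex c = P.vertex d := by
  obtain ⟨n, rfl⟩ := (P.closedVertex_eq_iff.1 h).exists_nat_pow_eq
  exact (P.vertex_rotation_pow hc n).symm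

/-- Distinct interior vertices and boundary components give distinct vertices of the closed
surface. -/
theorem card_interiorVertex_add_card_boundaryComponent_le [Finite F] :
    Nat.card {v // ¬ P.IsBoundaryVertex v} + Nat.card P.BoundaryComponent ≤
      Nat.card P.ClosedVertex := by
  rw [← Nat.card_sum]
  have hv := P.vertex_cornerAt
  have hb (b : P.BoundaryComponent) :
      P.boundaryComponent (Quot.out b).1 (Quot.out b).2 = b := Quot.out_eq b
  have hvb (v : {v // ¬ P.IsBoundaryVertex v}) (b : P.BoundaryComponent) :
      P.closedVertex (P.cornerAt v.1) ≠ P.closedVertex (Quot.out b).1 := by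
    intro h
    have hv' := P.vertex_eq_of_closedVertex_eq (by rw [hv]; exact v.2) h
    exact v.2 ⟨_, (Quot.out b).2, .inl (by rw [← hv', hv])⟩
  refine Nat.card_le_card_of_injective
    (Sum.elim (fun v => P.closedVertex (P.cornerAt v.1)) fun b => P.closedVertex (Quot.out b).1) ?_
  rintro (v | b) (v' | b') h
  · have := P.vertex_eq_of_closedVertex_eq (by rw [hv]; exact v.2) h
    rw [hv, hv] at this
    rw [Subtype.ext this]
  · exact absurd h (hvb v b')
  · exact absurd h.symm (hvb v' b)
  · have := P.boundaryComponent_eq_of_closedVertex_eq (Quot.out b).2 (Quot.out b').2 h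
    rw [hb, hb] at this
    rw [this]

/-- A boundary vertex is the starting point of a boundary edge. -/
theorem exists_isBoundaryEdge_vertex_eq [Finite F] {v : P.Vertex} (hv : P.IsBoundaryVertex v) :
    ∃ d, P.IsBoundaryEdge d ∧ P.vertex d = v := by
  obtain ⟨d, hd, rfl | rfl⟩ := hv
  · exact ⟨d, hd, rfl⟩
  by_contra! hno
  -- Turning around the end point of `d` never meets a boundary edge, but it comes back to `d`.
  have hstay (n : ℕ) : P.vertex ((P.rotation ^ n) (next d)) = P.vertex (next d) := by
    induction n with
    | zero => simp
    | succ n ih =>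
      rw [pow_succ', Equiv.Perm.mul_apply, P.vertex_rotation fun h => hno _ h ih, ih]
  have hcycle : P.rotation.SameCycle (next d) d := by
    rw [← P.rotation_of_isBoundaryEdge hd]
    exact Equiv.Perm.sameCycle_apply_left.2 (Equiv.Perm.SameCycle.refl _ _)
  obtain ⟨n, hn⟩ := hcycle.exists_nat_pow_eq
  exact hno d hd (by rw [← hstay n, hn])

theorem card_boundaryVertex_le [Finite F] :
    Nat.card {v // P.IsBoundaryVertex v} ≤ Nat.card {d // P.IsBoundaryEdge d} := by
  refine Nat.card_le_card_of_surjective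
    (fun d => ⟨P.vertex d.1, d.1, d.2, .inl rfl⟩) ?_
  rintro ⟨v, hv⟩
  obtain ⟨d, hd, rfl⟩ := P.exists_isBoundaryEdge_vertex_eq hv
  exact ⟨⟨d, hd⟩, rfl⟩

/-- The edge of the surface on which an oriented edge lies. -/
def edge (d : F × Fin 3) : P.Edge := Quot.mk _ d

theorem eq_or_eq_glue_of_edge_eq {d e : F × Fin 3} (h : P.edge d = P.edge e) :
    d = e ∨ d = P.glue e := by
  have key : ∀ a b, b = P.glue a → ({a, P.glue a} : Set (F × Fin 3)) = {b, P.glue b} := by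
    rintro a _ rfl
    rw [P.glue_glue, Set.pair_comm]
  have hset : ({d, P.glue d} : Set (F × Fin 3)) = {e, P.glue e} :=
    congrArg (Quot.lift (fun a => ({a, P.glue a} : Set (F × Fin 3))) key) h
  have hmem : d ∈ ({e, P.glue e} : Set (F × Fin 3)) := hset ▸ Set.mem_insert _ _
  simpa using hmem

/-- A chosen orientation of an edge of the surface. -/
noncomputable def orient (e : P.Edge) : F × Fin 3 := Quot.out e

theorem edge_orient (e : P.Edge) : P.edge (P.orient e) = e := Quot.out_eq e

/-- An edge of the surface that lies in the interior. -/
def IsInteriorEdge (e : P.Edge) : Prop := ¬ P.IsBoundaryEdge (P.orient e)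

theorem card_interiorEdge_add_card_boundaryEdge_le [Finite F] :
    Nat.card {e // P.IsInteriorEdge e} + Nat.card {d // P.IsBoundaryEdge d} ≤
      Nat.card P.Edge := by
  rw [← Nat.card_sum]
  have hout {d : F × Fin 3} (hd : P.IsBoundaryEdge d) : P.orient (P.edge d) = d := by
    rcases P.eq_or_eq_glue_of_edge_eq (P.edge_orient (P.edge d)) with h | h
    · exact h
    · exact h.trans hd
  refine Nat.card_le_card_of_injective (Sum.elim Subtype.val fun d => P.edge d.1) ?_
  rintro (e | d) (e' | d') h
  · exact congrArg Sum.inl (Subtype.ext h)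
  · refine absurd ?_ e.2
    simp only [Sum.elim_inl, Sum.elim_inr] at h
    rw [h, hout d'.2]
    exact d'.2
  · refine absurd ?_ e'.2
    simp only [Sum.elim_inl, Sum.elim_inr] at h
    rw [← h, hout d.2]
    exact d.2
  · have := congrArg P.orient h
    simp only [Sum.elim_inr] at this
    rw [hout d.2, hout d'.2] at this
    rw [Subtype.ext this]

/-- Euler's formula for the closed surface, as an inequality. -/
theorem HasGenus.card_interiorEdge_add_two_le [Finite F] {P : FlatConeSurface F}
    (h : P.HasGenus 0) :
    Nat.card {e // P.IsInteriorEdge e} + 2 ≤ Nat.card P.ClosedVertex + Nat.card F := by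
  classical
  have hχ := h.2
  rw [eulerChar] at hχ
  have h₁ := P.card_interiorVertex_add_card_boundaryComponent_le
  have h₂ := P.card_boundaryVertex_le
  have h₃ := P.card_interiorEdge_add_card_boundaryEdge_le
  have h₄ : Nat.card {v // P.IsBoundaryVertex v} + Nat.card {v // ¬ P.IsBoundaryVertex v} =
      Nat.card P.Vertex := by
    rw [← Nat.card_sum, Nat.card_congr (Equiv.sumCompl _)]
  omega

/-! ### Cochains of the closed surface -/

section Cochains

variable (R : Type*) [CommRing R]

/-- The functions on the oriented edges that change sign when the orientation is reversed. -/
def antisymmetric : Submodule R (F × Fin 3 → R) where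
  carrier := {x | ∀ d, x (P.glue d) = -x d}
  add_mem' hx hy d := by simp [hx d, hy d, add_comm]
  zero_mem' d := by simp
  smul_mem' r x hx d := by simp [hx d]

variable [Fintype F]

open Classical in
/-- The sums of a function on the oriented edges over the edges that start at the vertices of the
closed surface. -/
noncomputable def divergence : (F × Fin 3 → R) →ₗ[R] (P.ClosedVertex → R) where
  toFun x w := ∑ d, if P.closedVertex d = w then x d else 0
  map_add' x y := by
    ext w
    simp only [Pi.add_apply, ← Finset.sum_add_distrib]
    exact Finset.sum_congr rfl fun d _ => by split_ifs <;> simp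
  map_smul' r x := by
    ext w
    simp only [Pi.smul_apply, smul_eq_mul, RingHom.id_apply, Finset.mul_sum]
    exact Finset.sum_congr rfl fun d _ => by split_ifs <;> simp

open Classical in
theorem divergence_apply (x : F × Fin 3 → R) (w : P.ClosedVertex) :
    P.divergence R x w = ∑ d, if P.closedVertex d = w then x d else 0 := rfl

theorem sum_divergence (x : F × Fin 3 → R) : ∑ w, P.divergence R x w = ∑ d, x d := by
  classical
  simp only [divergence_apply]
  rw [Finset.sum_comm]
  exact Finset.sum_congr rfl fun d _ => by
    rw [Finset.sum_ite_eq, if_pos (Finset.mem_univ _)]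

/-- The range of the divergence on antisymmetric functions. -/
noncomputable def divergenceRange : Submodule R (P.ClosedVertex → R) :=
  (P.antisymmetric R).map (P.divergence R)

open Classical in
theorem divergence_single (d : F × Fin 3) :
    P.divergence R (Pi.single d 1) = Pi.single (P.closedVertex d) 1 := by
  ext w
  simp only [divergence_apply, Pi.single_apply]
  rw [Finset.sum_eq_single d (fun e _ he => by simp [he]) (by simp)]
  simp [eq_comm]

open Classical in
theorem single_sub_single_glue_mem (d : F × Fin 3) :
    (Pi.single (P.closedVertex d) 1 - Pi.single (P.closedVertex (P.glue d)) 1 :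
      P.ClosedVertex → R) ∈ P.divergenceRange R := by
  refine ⟨Pi.single d 1 - Pi.single (P.glue d) 1, fun e => ?_, ?_⟩
  · have h₁ : P.glue e = d ↔ e = P.glue d :=
      ⟨fun h => by rw [← h, P.glue_glue], fun h => by rw [h, P.glue_glue]⟩
    have h₂ : P.glue e = P.glue d ↔ e = d :=
      ⟨fun h => by rw [← P.glue_glue e, h, P.glue_glue], fun h => by rw [h]⟩
    simp [Pi.single_apply, h₁, h₂]
  · rw [map_sub, divergence_single, divergence_single]

open Classical in
/-- On a connected surface any two vertices of the closed surface are joined by a path of edges,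
which carries a unit flow from one to the other. -/
theorem Connected.single_sub_single_mem {P : FlatConeSurface F} (hP : P.Connected)
    (v w : P.ClosedVertex) :
    (Pi.single v 1 - Pi.single w 1 : P.ClosedVertex → R) ∈ P.divergenceRange R := by
  set S := P.divergenceRange R
  let u (d : F × Fin 3) : P.ClosedVertex → R := Pi.single (P.closedVertex d) 1
  have trans {a b c : F × Fin 3} (hab : u a - u b ∈ S) (hbc : u b - u c ∈ S) : u a - u c ∈ S := by
    simpa using S.add_mem hab hbc
  have symm {a b : F × Fin 3} (hab : u a - u b ∈ S) : u b - u a ∈ S := by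
    simpa using S.neg_mem hab
  have hglue (d : F × Fin 3) : u d - u (P.glue d) ∈ S := P.single_sub_single_glue_mem R d
  have hnext (d : F × Fin 3) : u d - u (next d) ∈ S := by
    have : u (next d) = u (P.glue d) := by simp only [u, P.closedVertex_next]
    rw [this]
    exact hglue d
  have hface (f : F) (i : Fin 3) : u (f, 0) - u (f, i) ∈ S := by
    have h₁ : u (f, 0) - u (f, 1) ∈ S := by simpa [next] using hnext (f, 0)
    have h₂ : u (f, 1) - u (f, 2) ∈ S := by simpa [next] using hnext (f, 1)
    fin_cases i
    · simp
    · exact h₁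
    · exact trans h₁ h₂
  have hpath {f g : F} (γ : P.FacePath f g) : u (f, 0) - u (g, 0) ∈ S := by
    induction γ with
    | nil f => simp
    | cons d hd γ ih =>
      exact trans (hface d.1 d.2) (trans (hglue d)
        (trans (symm (hface (P.glue d).1 (P.glue d).2)) ih))
  have hall (a b : F × Fin 3) : u a - u b ∈ S := by
    obtain ⟨γ⟩ := hP.2 a.1 b.1
    exact trans (symm (hface a.1 a.2)) (trans (hpath γ) (hface b.1 b.2))
  obtain ⟨a, rfl⟩ := Quotient.exists_rep v
  obtain ⟨b, rfl⟩ := Quotient.exists_rep w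
  exact hall a b

/-- On a connected surface every function on the vertices of the closed surface with sum zero is
the divergence of a flow. -/
theorem Connected.mem_divergenceRange {P : FlatConeSurface F} (hP : P.Connected)
    {κ : P.ClosedVertex → R} (hκ : ∑ w, κ w = 0) : κ ∈ P.divergenceRange R := by
  classical
  obtain ⟨f⟩ := hP.1
  set w₀ := P.closedVertex (f, 0)
  have : κ = ∑ w, κ w • (Pi.single w 1 - Pi.single w₀ 1 : P.ClosedVertex → R) := by
    simp only [smul_sub, Finset.sum_sub_distrib, ← Finset.sum_smul, hκ, zero_smul, sub_zero]
    ext v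
    simp [Finset.sum_apply, Pi.single_apply]
  rw [this]
  exact Submodule.sum_mem _ fun w _ =>
    Submodule.smul_mem _ _ (hP.single_sub_single_mem R w w₀)

end Cochains

/-- The difference of a function on the faces across each oriented edge. -/
def coboundary : (F → ℝ) →ₗ[ℝ] (F × Fin 3 → ℝ) where
  toFun h d := h (P.glue d).1 - h d.1
  map_add' h k := by ext d; simp only [Pi.add_apply]; ring
  map_smul' r h := by ext d; simp [mul_sub]

theorem coboundary_apply (h : F → ℝ) (d : F × Fin 3) :
    P.coboundary h d = h (P.glue d).1 - h d.1 := rfl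

theorem coboundary_mem_antisymmetric (h : F → ℝ) : P.coboundary h ∈ P.antisymmetric ℝ := by
  intro d
  simp only [coboundary_apply, P.glue_glue, neg_sub]

variable [Fintype F]

/-- Both the faces `d.1` and `(glue d).1` in the sum over a cycle run through the faces at the
cycle, since `(glue d).1` is the face of `rotation d`. -/
theorem divergence_coboundary (h : F → ℝ) : P.divergence ℝ (P.coboundary h) = 0 := by
  classical
  ext w
  have hperm : ∑ d, (if P.closedVertex (P.rotation d) = w then h (P.rotation d).1 else 0) =
      ∑ d, if P.closedVertex d = w then h d.1 else 0 :=
    Equiv.sum_comp P.rotation fun d => if P.closedVertex d = w then h d.1 else 0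
  rw [← sub_eq_zero, ← Finset.sum_sub_distrib] at hperm
  refine Eq.trans ?_ hperm
  rw [divergence_apply]
  refine Finset.sum_congr rfl fun d _ => ?_
  rw [P.closedVertex_rotation]
  split_ifs
  · rfl
  · exact (sub_zero 0).symm

theorem finrank_antisymmetric_le :
    Module.finrank ℝ (P.antisymmetric ℝ) ≤ Nat.card {e // P.IsInteriorEdge e} := by
  classical
  have := Fintype.ofFinite {e // P.IsInteriorEdge e}
  let r : P.antisymmetric ℝ →ₗ[ℝ] ({e // P.IsInteriorEdge e} → ℝ) :=
    (LinearMap.funLeft ℝ ℝ fun e => P.orient e.1) ∘ₗ (P.antisymmetric ℝ).subtype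
  have hr : Function.Injective r := by
    rw [← LinearMap.ker_eq_bot, LinearMap.ker_eq_bot']
    rintro ⟨x, hx⟩ h0
    have hout (e : P.Edge) : x (P.orient e) = 0 := by
      by_cases he : P.IsInteriorEdge e
      · exact congrFun h0 ⟨e, he⟩
      · have h1 := hx (P.orient e)
        rw [show P.glue (P.orient e) = P.orient e from not_not.1 he] at h1
        linarith
    ext d
    change x d = 0
    rcases P.eq_or_eq_glue_of_edge_eq (P.edge_orient (P.edge d)).symm with h | h
    · rw [h, hout]
    · rw [h, hx, hout, neg_zero]
  calc Module.finrank ℝ (P.antisymmetric ℝ)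
      ≤ Module.finrank ℝ ({e // P.IsInteriorEdge e} → ℝ) :=
        LinearMap.finrank_le_finrank_of_injective hr
    _ = Nat.card {e // P.IsInteriorEdge e} := by
        rw [Module.finrank_fintype_fun_eq_card, Nat.card_eq_fintype_card]

theorem Connected.card_face_le_finrank_range_coboundary {P : FlatConeSurface F}
    (hP : P.Connected) :
    Nat.card F ≤ Module.finrank ℝ (LinearMap.range P.coboundary) + 1 := by
  obtain ⟨f₀⟩ := hP.1
  have hconst {h : F → ℝ} (hh : P.coboundary h = 0) {f g : F} (γ : P.FacePath f g) :
      h f = h g := by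
    induction γ with
    | nil f => rfl
    | cons d hd γ ih => rw [← ih]; exact (sub_eq_zero.1 (congrFun hh d)).symm
  have hker : Module.finrank ℝ (LinearMap.ker P.coboundary) ≤ 1 := by
    let ev : LinearMap.ker P.coboundary →ₗ[ℝ] ℝ :=
      LinearMap.proj f₀ ∘ₗ (LinearMap.ker P.coboundary).subtype
    rw [← Module.finrank_self ℝ]
    refine LinearMap.finrank_le_finrank_of_injective (f := ev) ?_
    rw [← LinearMap.ker_eq_bot, LinearMap.ker_eq_bot']
    rintro ⟨h, hh⟩ h0
    ext f
    obtain ⟨γ⟩ := hP.2 f f₀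
    exact (hconst hh γ).trans h0
  have := LinearMap.finrank_range_add_finrank_ker P.coboundary
  rw [Module.finrank_fintype_fun_eq_card, ← Nat.card_eq_fintype_card] at this
  omega

theorem Connected.card_closedVertex_le_finrank_divergenceRange {P : FlatConeSurface F}
    (hP : P.Connected) :
    Nat.card P.ClosedVertex ≤ Module.finrank ℝ (P.divergenceRange ℝ) + 1 := by
  let s : (P.ClosedVertex → ℝ) →ₗ[ℝ] ℝ := ∑ w, LinearMap.proj w
  have hle : LinearMap.ker s ≤ P.divergenceRange ℝ := fun κ hκ =>
    hP.mem_divergenceRange ℝ (by simpa [s, LinearMap.sum_apply] using hκ)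
  have h₁ := Submodule.finrank_mono hle
  have h₂ := LinearMap.finrank_range_add_finrank_ker s
  have h₃ : Module.finrank ℝ (LinearMap.range s) ≤ 1 :=
    (Submodule.finrank_le _).trans_eq (Module.finrank_self ℝ)
  rw [Module.finrank_fintype_fun_eq_card, ← Nat.card_eq_fintype_card] at h₂
  omega

/-- The first cohomology of the closed surface vanishes in genus zero: by Euler's formula the
coboundaries fill the space of divergence-free antisymmetric functions. -/
theorem HasGenus.exists_coboundary_eq {P : FlatConeSurface F} (hP : P.HasGenus 0)
    {x : F × Fin 3 → ℝ} (hx : x ∈ P.antisymmetric ℝ) (hdiv : P.divergence ℝ x = 0) :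
    ∃ h, P.coboundary h = x := by
  let D := (P.divergence ℝ).domRestrict (P.antisymmetric ℝ)
  let δ : (F → ℝ) →ₗ[ℝ] P.antisymmetric ℝ :=
    P.coboundary.codRestrict _ P.coboundary_mem_antisymmetric
  have hle : LinearMap.range δ ≤ LinearMap.ker D := by
    rintro _ ⟨h, rfl⟩
    exact P.divergence_coboundary h
  have hδ : Module.finrank ℝ (LinearMap.range δ) =
      Module.finrank ℝ (LinearMap.range P.coboundary) := by
    have h₁ := LinearMap.finrank_range_add_finrank_ker δ
    have h₂ := LinearMap.finrank_range_add_finrank_ker P.coboundary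
    rw [LinearMap.ker_codRestrict] at h₁
    omega
  have hD : LinearMap.range D = P.divergenceRange ℝ := LinearMap.range_domRestrict _ _
  have h₁ := LinearMap.finrank_range_add_finrank_ker D
  rw [hD] at h₁
  have h₂ := hP.1.card_closedVertex_le_finrank_divergenceRange
  have h₃ := hP.1.card_face_le_finrank_range_coboundary
  have h₄ := P.finrank_antisymmetric_le
  have h₅ := hP.card_interiorEdge_add_two_le
  have heq := Submodule.eq_of_le_of_finrank_le hle (by omega)
  have hmem : (⟨x, hx⟩ : P.antisymmetric ℝ) ∈ LinearMap.range δ := heq ▸ hdiv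
  obtain ⟨h, hh⟩ := hmem
  exact ⟨h, congrArg Subtype.val hh⟩

end FlatConeSurface

/-! ### Quarter turns -/

theorem mem_quarterTurns_iff {z : Circle} : z ∈ quarterTurns ↔ z ^ 4 = 1 := by
  rw [quarterTurns, Subgroup.mem_zpowers_iff]
  constructor
  · rintro ⟨k, rfl⟩
    rw [← Circle.exp_intCast_mul, ← Circle.exp_natCast_mul, Circle.exp_eq_one]
    exact ⟨k, by push_cast; ring⟩
  · intro h
    rw [← Circle.exp_arg z, ← Circle.exp_natCast_mul, Circle.exp_eq_one] at h
    obtain ⟨k, hk⟩ := h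
    refine ⟨k, ?_⟩
    rw [← Circle.exp_intCast_mul, ← Circle.exp_arg z]
    congr 1
    push_cast at hk
    linarith

theorem Circle.exp_sum {ι : Type*} (s : Finset ι) (g : ι → ℝ) :
    Circle.exp (∑ i ∈ s, g i) = ∏ i ∈ s, Circle.exp (g i) := by
  classical
  induction s using Finset.induction_on with
  | empty => simp
  | insert i s hi ih => rw [Finset.sum_insert hi, Finset.prod_insert hi, Circle.exp_add, ih]

namespace FlatConeSurface

variable {F : Type*} (P : FlatConeSurface F)

/-! ### Angles and parallel transport around a vertex -/

theorem coe_edgeRotation (d : F × Fin 3) :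
    (P.edgeRotation d : ℂ) = -P.edgeVector (P.glue d) / P.edgeVector d := rfl

theorem edgeRotation_mul_edgeRotation_glue (d : F × Fin 3) :
    P.edgeRotation d * P.edgeRotation (P.glue d) = 1 := by
  apply Subtype.ext
  have h₁ := P.edgeVector_ne_zero d
  have h₂ := P.edgeVector_ne_zero (P.glue d)
  rw [Circle.coe_mul, coe_edgeRotation, coe_edgeRotation, P.glue_glue, Circle.coe_one]
  field_simp

/-- The direction of an oriented edge, in the coordinates of its triangle. -/
noncomputable def direction (d : F × Fin 3) : Circle :=
  ⟨P.edgeVector d / ‖P.edgeVector d‖, mem_sphere_zero_iff_norm.mpr (by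
    simp [P.edgeVector_ne_zero d])⟩

theorem coe_direction (d : F × Fin 3) :
    (P.direction d : ℂ) = P.edgeVector d / ‖P.edgeVector d‖ := rfl

theorem norm_edgeVector_glue (d : F × Fin 3) :
    ‖P.edgeVector (P.glue d)‖ = ‖P.edgeVector d‖ := by
  have h := P.dist_glue d
  rw [dist_comm, dist_comm (P.point d.1 d.2), dist_eq_norm, dist_eq_norm] at h
  exact h

/-- A triangle is counterclockwise as seen from each of its corners. -/
theorem im_conj_mul_pos (f : F) (i : Fin 3) :
    0 < ((starRingEnd ℂ) (P.point f (i + 1) - P.point f i) *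
      (P.point f (i + 2) - P.point f i)).im := by
  have h := P.counterclockwise f
  simp only [Complex.mul_im, Complex.conj_re, Complex.conj_im, Complex.sub_re,
    Complex.sub_im] at h ⊢
  fin_cases i
  · simpa using h
  · simp only [Fin.mk_one, Fin.isValue, Fin.reduceAdd]
    linarith
  · simp only [Fin.reduceFinMk, Fin.isValue, Fin.reduceAdd]
    linarith

/-- The interior angle at the corner of a counterclockwise triangle rotates the first side at that
corner to the second one. -/
theorem exp_cornerAngle_mul_direction (f : F) (i : Fin 3) :
    (Circle.exp (P.cornerAngle (f, i)) * P.direction (f, i) : ℂ) =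
      -P.edgeVector (f, i + 2) / ‖P.edgeVector (f, i + 2)‖ := by
  have hx : P.edgeVector (f, i) ≠ 0 := P.edgeVector_ne_zero (f, i)
  have hy : -P.edgeVector (f, i + 2) ≠ 0 := neg_ne_zero.2 (P.edgeVector_ne_zero (f, i + 2))
  have hy' : -P.edgeVector (f, i + 2) = P.point f (i + 2) - P.point f i := by
    have : i + 2 + 1 = i := by fin_cases i <;> rfl
    simp [edgeVector, this]
  have him : 0 < (-P.edgeVector (f, i + 2) / P.edgeVector (f, i)).im := by
    have h := P.im_conj_mul_pos f i
    rw [← hy'] at h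
    change 0 < ((starRingEnd ℂ) (P.edgeVector (f, i)) * _).im at h
    rw [div_eq_mul_inv, Complex.inv_def, mul_comm, mul_right_comm,
      Complex.im_mul_ofReal]
    exact mul_pos h (inv_pos.2 (Complex.normSq_pos.2 hx))
  have hangle : P.cornerAngle (f, i) =
      (-P.edgeVector (f, i + 2) / P.edgeVector (f, i)).arg := by
    rw [cornerAngle, EuclideanGeometry.angle, InnerProductGeometry.angle_comm]
    simp only [vsub_eq_sub]
    rw [← hy']
    change InnerProductGeometry.angle _ (P.edgeVector (f, i)) = _
    rw [Complex.angle_eq_abs_arg hy hx, abs_of_nonneg (Complex.arg_nonneg_iff.2 him.le)]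
  have hpolar := Complex.norm_mul_exp_arg_mul_I (-P.edgeVector (f, i + 2) / P.edgeVector (f, i))
  rw [← hangle, norm_div, norm_neg] at hpolar
  have hx' : (‖P.edgeVector (f, i)‖ : ℂ) ≠ 0 := by simpa using hx
  have hy'' : (‖P.edgeVector (f, i + 2)‖ : ℂ) ≠ 0 := by
    simpa using P.edgeVector_ne_zero (f, i + 2)
  rw [Circle.coe_exp, coe_direction]
  push_cast at hpolar
  field_simp at hpolar ⊢
  linear_combination hpolar

theorem exp_cornerAngle_rotation (d : F × Fin 3) :
    Circle.exp (P.cornerAngle (P.rotation d)) * P.direction (P.rotation d) =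
      P.edgeRotation d * P.direction d := by
  apply Subtype.ext
  have hprev : ((P.glue d).1, (P.glue d).2 + 1 + 2) = P.glue d := by
    have (i : Fin 3) : i + 1 + 2 = i := by fin_cases i <;> rfl
    rw [this]
  rw [Circle.coe_mul, P.rotation_apply, next, P.exp_cornerAngle_mul_direction, hprev,
    P.norm_edgeVector_glue, Circle.coe_mul, coe_edgeRotation, coe_direction]
  have := P.edgeVector_ne_zero d
  field_simp

variable [Fintype F]

open Classical in
/-- Parallel transport once around a vertex of the closed surface rotates by the total angle
there. -/
theorem prod_edgeRotation (w : P.ClosedVertex) :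
    ∏ d, (if P.closedVertex d = w then P.edgeRotation d else 1) =
      Circle.exp (∑ d, if P.closedVertex d = w then P.cornerAngle d else 0) := by
  have hθ := Equiv.prod_comp P.rotation fun d =>
    Circle.exp (if P.closedVertex d = w then P.cornerAngle d else 0)
  have hu := Equiv.prod_comp P.rotation fun d =>
    if P.closedVertex d = w then P.direction d else 1
  rw [Circle.exp_sum, ← hθ]
  -- The directions of the edges telescope along the cycle.
  refine mul_right_cancel (b := ∏ d, if P.closedVertex d = w then P.direction d else 1) ?_
  nth_rewrite 2 [← hu]
  rw [← Finset.prod_mul_distrib, ← Finset.prod_mul_distrib]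
  refine Finset.prod_congr rfl fun d _ => ?_
  rw [P.closedVertex_rotation]
  split_ifs
  · exact (P.exp_cornerAngle_rotation d).symm
  · simp

open Classical in
theorem sum_cornerAngle_eq_sum_totalAngle (w : P.ClosedVertex) :
    (∑ d, if P.closedVertex d = w then P.cornerAngle d else 0) =
      ∑ v : P.Vertex, if P.closedVertex (P.cornerAt v) = w then P.totalAngle v else 0 := by
  have hout (d : F × Fin 3) : P.closedVertex (P.cornerAt (P.vertex d)) = P.closedVertex d :=
    P.closedVertex_eq_of_vertex_eq (P.vertex_cornerAt (P.vertex d))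
  simp only [totalAngle]
  have hswap (v : P.Vertex) : (if P.closedVertex (P.cornerAt v) = w then
        ∑ c : F × Fin 3, (if P.vertex c = v then P.cornerAngle c else 0) else 0) =
      ∑ c : F × Fin 3, if P.vertex c = v then
        (if P.closedVertex c = w then P.cornerAngle c else 0) else 0 := by
    have hcv (c : F × Fin 3) : (if P.vertex c = v then
          (if P.closedVertex c = w then P.cornerAngle c else 0) else 0) =
        if P.closedVertex (P.cornerAt v) = w then
          (if P.vertex c = v then P.cornerAngle c else 0) else 0 := by
      by_cases hc : P.vertex c = v
      · subst hc
        rw [if_pos rfl, if_pos rfl, hout]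
      · simp [hc]
    rw [Finset.sum_congr rfl fun c _ => hcv c]
    split_ifs <;> simp
  rw [Finset.sum_congr rfl fun v _ => hswap v, Finset.sum_comm]
  exact Finset.sum_congr rfl fun d _ => by
    rw [Finset.sum_ite_eq, if_pos (Finset.mem_univ _)]

open Classical in
theorem prod_edgeRotation_pow_four (hP : ∀ v, ∃ n : ℤ, P.curvature v = n * π / 2)
    (w : P.ClosedVertex) :
    ∏ d, (if P.closedVertex d = w then P.edgeRotation d ^ 4 else 1) = 1 := by
  have htotal (v : P.Vertex) : ∃ n : ℤ, P.totalAngle v = n * (π / 2) := by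
    obtain ⟨n, hn⟩ := hP v
    rw [curvature] at hn
    split_ifs at hn
    · exact ⟨2 - n, by push_cast; linarith⟩
    · exact ⟨4 - n, by push_cast; linarith⟩
  choose n hn using htotal
  have hpow : ∏ d, (if P.closedVertex d = w then P.edgeRotation d ^ 4 else 1) =
      (∏ d, if P.closedVertex d = w then P.edgeRotation d else 1) ^ 4 := by
    rw [← Finset.prod_pow]
    exact Finset.prod_congr rfl fun d _ => by split_ifs <;> simp
  rw [hpow, P.prod_edgeRotation, P.sum_cornerAngle_eq_sum_totalAngle, ← mem_quarterTurns_iff]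
  refine Subgroup.mem_zpowers_iff.2
    ⟨∑ v : P.Vertex, if P.closedVertex (P.cornerAt v) = w then n v else 0, ?_⟩
  rw [← Circle.exp_intCast_mul, Int.cast_sum, Finset.sum_mul]
  congr 1
  exact Finset.sum_congr rfl fun v _ => by split_ifs <;> simp [hn]

/-! ### The potential of the parallel transport -/

/-- Modulo quarter turns, parallel transport across an edge in genus zero is the rotation by the
difference of a function on the triangles, measured in quarter turns. -/
theorem HasGenus.exists_edgeRotation_pow_four_eq {P : FlatConeSurface F} (hgenus : P.HasGenus 0)
    (hP : ∀ v, ∃ n : ℤ, P.curvature v = n * π / 2) :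
    ∃ h : F → ℝ, ∀ d, P.edgeRotation d ^ 4 = Circle.exp (2 * π * (h (P.glue d).1 - h d.1)) := by
  classical
  -- In units of a quarter turn, half the difference of the arguments of two inverse rotations. It
  -- is antisymmetric even where both arguments are `π`; in exchange it determines the rotation only
  -- up to half a turn, which the fourth power does not see.
  let x (d : F × Fin 3) : ℝ :=
    ((P.edgeRotation d : ℂ).arg - (P.edgeRotation (P.glue d) : ℂ).arg) / π
  have hx : x ∈ P.antisymmetric ℝ := fun d => by simp only [x, P.glue_glue]; ring
  have hexp (d : F × Fin 3) : Circle.exp (2 * π * x d) = P.edgeRotation d ^ 4 := by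
    have hinv : P.edgeRotation (P.glue d) = (P.edgeRotation d)⁻¹ :=
      (inv_eq_of_mul_eq_one_right (P.edgeRotation_mul_edgeRotation_glue d)).symm
    have h2 : 2 * π * x d =
        ((2 : ℕ) : ℝ) * (P.edgeRotation d : ℂ).arg -
          ((2 : ℕ) : ℝ) * (P.edgeRotation (P.glue d) : ℂ).arg := by
      simp only [x]
      field_simp
      push_cast
      ring
    rw [h2, Circle.exp_sub, Circle.exp_natCast_mul, Circle.exp_natCast_mul, Circle.exp_arg,
      Circle.exp_arg, hinv, inv_pow, div_inv_eq_mul, ← pow_add]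
  have hint (w : P.ClosedVertex) : ∃ m : ℤ, P.divergence ℝ x w = m := by
    have hsum : Circle.exp (2 * π * P.divergence ℝ x w) = 1 := by
      rw [← P.prod_edgeRotation_pow_four hP w, divergence_apply, Finset.mul_sum]
      rw [Circle.exp_sum]
      refine Finset.prod_congr rfl fun d _ => ?_
      split_ifs
      · exact hexp d
      · simp
    obtain ⟨m, hm⟩ := Circle.exp_eq_one.1 hsum
    refine ⟨m, ?_⟩
    have := Real.pi_pos
    rw [mul_comm] at hm
    exact mul_right_cancel₀ (by positivity) hm
  choose κ hκ using hint
  have hκ0 : ∑ w, κ w = 0 := by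
    have hx0 : ∑ d, x d = 0 := by
      have hglue : Function.Involutive P.glue := P.glue_glue
      have h := Equiv.sum_comp (Function.Involutive.toPerm P.glue hglue) x
      have h' : ∑ d, x ((Function.Involutive.toPerm P.glue hglue) d) = -∑ d, x d := by
        rw [← Finset.sum_neg_distrib]
        exact Finset.sum_congr rfl fun d _ => hx d
      linarith
    have h := P.sum_divergence ℝ x
    rw [hx0] at h
    simp only [hκ] at h
    exact_mod_cast h
  obtain ⟨y, hy, hyκ⟩ := hgenus.1.mem_divergenceRange ℤ hκ0
  -- An integer correction is invisible to the fourth power and makes `x` divergence-free.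
  let z (d : F × Fin 3) : ℝ := x d - y d
  have hz : z ∈ P.antisymmetric ℝ := fun d => by
    simp only [z, hx d, hy d]
    push_cast
    ring
  have hzdiv : P.divergence ℝ z = 0 := by
    ext w
    have hyw : P.divergence ℝ (fun d => (y d : ℝ)) w = κ w := by
      rw [← hyκ, divergence_apply, divergence_apply]
      push_cast
      rfl
    have hzxy : z = x - fun d => (y d : ℝ) := rfl
    rw [hzxy, map_sub, Pi.sub_apply, hyw, hκ, sub_self, Pi.zero_apply]
  obtain ⟨h, hh⟩ := hgenus.exists_coboundary_eq hz hzdiv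
  refine ⟨h, fun d => ?_⟩
  have hd : h (P.glue d).1 - h d.1 = x d - y d := congrFun hh d
  rw [hd, mul_sub, Circle.exp_sub, Circle.exp_two_pi_mul_int, div_one, hexp]

end FlatConeSurface

open FlatConeSurface in
theorem mainTheorem3 {F : Type*} [Fintype F] (P : FlatConeSurface F)
    (hgenus : P.HasGenus 0)
    (Γ₁ Γ₂ : Finset P.Vertex) (k l : P.Vertex → ℤ)
    (hΓ₁ : ∀ v ∈ Γ₁, ¬ P.IsBoundaryVertex v)
    (hΓ₂ : ∀ v ∈ Γ₂, P.IsBoundaryVertex v)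
    (hflat : ∀ v, v ∉ Γ₁ → v ∉ Γ₂ → P.curvature v = 0)
    (hk : ∀ v ∈ Γ₁, P.curvature v = (k v : ℝ) * Real.pi / 2)
    (hl : ∀ v ∈ Γ₂, P.curvature v = (l v : ℝ) * Real.pi / 2)
    (hGaussBonnet : ∑ v ∈ Γ₁, k v + ∑ v ∈ Γ₂, l v = 4 * P.eulerChar)
    (f : F) :
    P.holonomyGroup f ≤ quarterTurns := by
  have hP (v : P.Vertex) : ∃ n : ℤ, P.curvature v = n * π / 2 := by
    by_cases h₁ : v ∈ Γ₁
    · exact ⟨k v, hk v h₁⟩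
    by_cases h₂ : v ∈ Γ₂
    · exact ⟨l v, hl v h₂⟩
    exact ⟨0, by simpa using hflat v h₁ h₂⟩
  obtain ⟨h, hh⟩ := hgenus.exists_edgeRotation_pow_four_eq hP
  have hpath {f g : F} (γ : P.FacePath f g) :
      transport γ ^ 4 = Circle.exp (2 * π * (h g - h f)) := by
    induction γ with
    | nil f => simp [transport]
    | cons d hd γ ih =>
      rw [transport, mul_pow, ih, hh, ← Circle.exp_add]
      ring_nf
  rintro _ ⟨γ, rfl⟩
  rw [mem_quarterTurns_iff, hpath γ, sub_self, mul_zero, Circle.exp_zero]
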